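/- A rooted tree is a finite tree (a connected finite graph without cycles) with a distinguished root vertex; edges are oriented towards the root. The tree order on its vertices is generated by these edges: $v\le w$ if there is a downward path from $v$ to $w$ (so the root is the largest element). A planar rooted tree is a rooted tree with a total order on the set of incoming edges at each vertex; its vertices are then totally ordered by the depth-first walk starting at the root (the depth-first ordering). Let $\mathbf{T}$ be the category whose objects are rooted trees and whose morphisms are the order embeddings (for the tree order) that preserve the root, and let $\mathbf{PT}$ be the category whose objects are planar rooted trees and whose morphisms are the order embeddings that preserve the root and the depth-first ordering. For an object $x$ of a category $\mathbf{C}$, let $\mathbf{C}_x$ be the collection of all morphisms with domain $x$. The divisibility order on $\mathbf{C}_x$ is the quasi-order with $f\le g$ iff $g=hf$ for some morphism $h$. An admissible order on $\mathbf{C}_x$ is a well-order $\preceq$ such that $f\preceq f'$ implies $gf\preceq gf'$ for all $f,f'\colon x\to y$ and $g\colon y\to z$. An essentially small category $\mathbf{C}$ is Gröbner if it is directed (every endomorphism is an identity), every divisibility order on $\mathbf{C}_x$ is a well-quasi-order, and every $\mathbf{C}_x$ has an admissible order. For a field $k$, a representation of $\mathbf{C}$ is a functor from $\mathbf{C}$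 to $k$-vector spaces; it is finitely generated if some finite set of its elements lies in no proper subrepresentation. A functor $i\colon\mathbf{C}'\to\mathbf{C}$ has property (F) over $k$ if for every object $x$ of $\mathbf{C}$ the pullback $i^*P_x$ of the principal projective $P_x=k\,\mathbf{C}(x,-)$ is a finitely generated representation of $\mathbf{C}'$. A category is quasi-Gröbner over $k$ if it receives an essentially surjective functor with property (F) over $k$ from a Gröbner category. Theorem. The category $\mathbf{PT}$ is Gröbner, and the forgetful functor $\mathbf{PT}\to\mathbf{T}$ is essentially surjective and has property (F) over every field $k$. Consequently $\mathbf{T}$ is quasi-Gröbner over every field $k$. -/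

import Mathlib

open CategoryTheory

universe u v w t

/-- A rooted tree: a finite graph that is a tree, together with a root vertex. -/
structure RTree where
  V : Type u
  finite : Finite V
  graph : SimpleGraph V
  isTree : graph.IsTree
  root : V

namespace RTree

/-- `T.Edge a b`: there is an edge between `a` and `b`, and oriented towards the root it goes
from `a` to `b` (so `b` is nearer to the root). -/
def Edge (T : RTree.{u}) (a b : T.V) : Prop :=
  T.graph.Adj a b ∧ T.graph.dist b T.root < T.graph.dist a T.root

/-- The incoming edges at `b`, each represented by its source vertex. -/
def In (T : RTree.{u}) (b : T.V) : Type u := {a : T.V // T.Edge a b}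

theorem dist_le_of_reflTransGen (T : RTree.{u}) {a b : T.V}
    (h : Relation.ReflTransGen T.Edge a b) :
    a = b ∨ T.graph.dist b T.root < T.graph.dist a T.root := by
  induction h with
  | refl => exact Or.inl rfl
  | tail _ hbc ih =>
    rcases ih with rfl | ih
    · exact Or.inr hbc.2
    · exact Or.inr (hbc.2.trans ih)

/-- The tree order: generated by the edges oriented towards the root, so `a ≤ b` iff there is a
downward path from `a` to `b`; the root is the largest element. -/
instance (T : RTree.{u}) : PartialOrder T.V where
  le := Relation.ReflTransGen T.Edge
  le_refl _ := Relation.ReflTransGen.refl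
  le_trans _ _ _ := Relation.ReflTransGen.trans
  le_antisymm a b hab hba := by
    rcases T.dist_le_of_reflTransGen hab with h | h
    · exact h
    · rcases T.dist_le_of_reflTransGen hba with h' | h'
      · exact h'.symm
      · exact absurd h (not_lt.mpr h'.le)

/-- Order embeddings (for the tree order) that preserve the root. -/
@[ext]
structure Hom (T U : RTree.{u}) where
  emb : T.V ↪o U.V
  map_root : emb T.root = U.root

/-- The category **T** of rooted trees. -/
instance : Category.{u} RTree.{u} where
  Hom := Hom
  id T := ⟨RelEmbedding.refl _, rfl⟩
  comp f g := ⟨f.emb.trans g.emb, (congrArg g.emb f.map_root).trans g.map_root⟩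

end RTree

/-- A planar rooted tree: a rooted tree with a total order on the incoming edges at each vertex. -/
structure PRTree extends RTree.{u} where
  inOrder : ∀ b : V, LinearOrder (toRTree.In b)

namespace PRTree

/-- The (strict) depth-first ordering: the order in which the vertices are first visited by the
depth-first walk which starts at the root and takes the incoming edges at each vertex in their
given order. Thus a vertex comes before everything above it in the tree, and if two incoming edges
at a vertex `b` have sources `c`, `c'` with `c` before `c'`, then everything in the branch at `c`
comes before everything in the branch at `c'`. -/
def DFLT (P : PRTree.{u}) (x y : P.V) : Prop :=
  y < x ∨ ∃ (b : P.V) (c c' : P.toRTree.In b), (P.inOrder b).lt c c' ∧ x ≤ c.1 ∧ y ≤ c'.1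

/-- Root-preserving order embeddings that preserve the depth-first ordering. -/
@[ext]
structure Hom (P Q : PRTree.{u}) where
  hom : P.toRTree ⟶ Q.toRTree
  map_dflt : ∀ x y : P.V, P.DFLT x y → Q.DFLT (hom.emb x) (hom.emb y)

/-- The category **PT** of planar rooted trees. -/
instance : Category.{u} PRTree.{u} where
  Hom := Hom
  id P := ⟨𝟙 P.toRTree, fun _ _ h => h⟩
  comp f g := ⟨f.hom ≫ g.hom, fun x y h => g.map_dflt _ _ (f.map_dflt x y h)⟩

/-- The forgetful functor **PT** ⥤ **T**. -/
def forget : PRTree.{u} ⥤ RTree.{u} where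
  obj P := P.toRTree
  map f := Hom.hom f

end PRTree

section Groebner

/-- `C_x`: all morphisms of `C` with domain `x`. -/
def MorphismsFrom {C : Type u} [Category.{v} C] (x : C) : Type (max u v) := Σ y : C, (x ⟶ y)

/-- The divisibility quasi-order on `C_x`: `f ≤ g` iff `g = hf` for some morphism `h`. -/
def Divides {C : Type u} [Category.{v} C] (x : C) (f g : MorphismsFrom x) : Prop :=
  ∃ h : f.1 ⟶ g.1, f.2 ≫ h = g.2

/-- An admissible order on `C_x`: a well-order such that `f ≼ f'` implies `gf ≼ gf'` for all
parallel `f, f' : x ⟶ y` and all `g : y ⟶ z`. -/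
def IsAdmissible {C : Type u} [Category.{v} C] (x : C) (o : LinearOrder (MorphismsFrom x)) : Prop :=
  WellFounded o.lt ∧
    ∀ (y z : C) (f f' : x ⟶ y) (g : y ⟶ z),
      o.le (⟨y, f⟩ : MorphismsFrom x) (⟨y, f'⟩ : MorphismsFrom x) →
      o.le (⟨z, f ≫ g⟩ : MorphismsFrom x) (⟨z, f' ≫ g⟩ : MorphismsFrom x)

/-- Gröbner categories: (essentially) small directed categories all of whose divisibility orders
are well-quasi-orders and all of whose sets `C_x` have an admissible order. Directed means that
every endomorphism is an identity. -/
structure IsGroebner (C : Type u) [Category.{v} C] : Prop where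
  essentiallySmall : EssentiallySmall.{v} C
  directed : ∀ (x : C) (f : x ⟶ x), f = 𝟙 x
  wellQuasiOrdered : ∀ x : C, WellQuasiOrdered (Divides x)
  admissible : ∀ x : C, ∃ o : LinearOrder (MorphismsFrom x), IsAdmissible x o

/-- A representation of `C` over a field `k` is a functor from `C` to `k`-vector spaces.
It is finitely generated if it has finitely many elements that are contained in
no proper subrepresentation; the subrepresentation generated by `e i ∈ M (y i)` is at `z` the
span of the images of the `e i` under all morphisms `y i ⟶ z`. -/
def IsFinitelyGenerated {k : Type w} [Field k] {C : Type u} [Category.{v} C]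
    (M : C ⥤ ModuleCat.{t} k) : Prop :=
  ∃ (n : ℕ) (y : Fin n → C) (e : ∀ i, M.obj (y i)), ∀ z : C,
    Submodule.span k {m : M.obj z | ∃ (i : Fin n) (g : y i ⟶ z), m = (M.map g).hom (e i)} = ⊤

/-- The principal projective `P_x = k C(x, -)`. -/
noncomputable def principalProjective (k : Type w) [Field k] {C : Type u} [Category.{v} C]
    (x : C) : C ⥤ ModuleCat.{max v w} k where
  obj y := ModuleCat.of k ((x ⟶ y) →₀ k)
  map g := ModuleCat.ofHom (Finsupp.lmapDomain k k (fun f => f ≫ g))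
  map_id y := by
    ext : 1
    refine Finsupp.lhom_ext' fun f => LinearMap.ext_ring ?_
    simp
  map_comp g h := by
    ext : 1
    refine Finsupp.lhom_ext' fun f => LinearMap.ext_ring ?_
    simp

/-- Property (F) for `i : D ⥤ C` over `k`: the pullback of every principal projective of `C` is a
finitely generated representation of `D`. -/
def HasPropertyF (k : Type w) [Field k] {C : Type u} [Category.{v} C] {D : Type t}
    [Category.{v} D] (i : D ⥤ C) : Prop :=
  ∀ x : C, IsFinitelyGenerated (i ⋙ principalProjective k x)

/-- Quasi-Gröbner categories: those which receive an essentially surjective functor with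
property (F) from a Gröbner category. -/
def IsQuasiGroebner (k : Type w) [Field k] (C : Type u) [Category.{v} C] : Prop :=
  ∃ (D : Type u) (_ : Category.{v} D) (i : D ⥤ C),
    IsGroebner D ∧ i.EssSurj ∧ HasPropertyF k i

end Groebner

/-! The vertices above which two depth-first comparisons take place lie in a chain, so the
depth-first ordering is a linear order (`dflt_trans`, `dflt_total`). A strictly increasing self-map
of a finite linear order is the identity, so `PT` is directed; comparing morphisms lexicographically
by their values gives admissible orders. Well-quasi-ordering is Kruskal's theorem with labels
(`wellQuasiOrdered_embeds`): mark the image of `f : P ⟶ Q` in `Q` by the vertices of `P`; a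
label-preserving embedding between two marked trees is a factorization of one morphism through the
other. For property (F), a planar structure on the codomain pulls back along any morphism of `T`
(`exists_planar_of_hom`), and a finite tree has only finitely many planar structures. -/

namespace RTree

/-! ### The tree order -/

/-- A geodesic from `b` to the root avoids `a`, which is farther away; prefixing the edge gives the
unique path from `a` to the root, so `b` is its second vertex. -/
theorem edge_rightUnique (T : RTree.{u}) : Relator.RightUnique T.Edge := by
  suffices h : ∀ ⦃a b⦄, T.Edge a b → ∀ p : T.graph.Walk a T.root, p.IsPath → b = p.snd by
    intro a b c hb hc
    obtain ⟨p, hp, -⟩ := T.isTree.connected.exists_path_of_dist a T.root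
    exact (h hb p hp).trans (h hc p hp).symm
  intro a b hb p hp
  obtain ⟨q, hq, hl⟩ := T.isTree.connected.exists_path_of_dist b T.root
  have ha : a ∉ q.support := by
    intro ha
    classical
    have h1 := T.graph.dist_le (q.dropUntil a ha)
    have h2 := q.length_dropUntil_le_length ha
    have := hb.2
    omega
  have hq' : (SimpleGraph.Walk.cons hb.1 q).IsPath := hq.cons ha
  have : p = SimpleGraph.Walk.cons hb.1 q := (T.isTree.existsUnique_path a T.root).unique hp hq'
  simp [this]

theorem edge_le {T : RTree.{u}} {a b : T.V} (h : T.Edge a b) : a ≤ b :=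
  Relation.ReflTransGen.single h

theorem edge_lt {T : RTree.{u}} {a b : T.V} (h : T.Edge a b) : a < b :=
  lt_of_le_of_ne (edge_le h) fun e => h.1.ne e

theorem le_root {T : RTree.{u}} (a : T.V) : a ≤ T.root := by
  induction hn : T.graph.dist a T.root using Nat.strong_induction_on generalizing a with
  | _ n ih =>
    by_cases ha : a = T.root
    · exact ha.le
    obtain ⟨p, hp⟩ := T.isTree.connected.exists_walk_length_eq_dist a T.root
    cases p with
    | nil => exact absurd rfl ha
    | @cons _ b _ hab q =>
      have h1 := T.graph.dist_le q
      rw [SimpleGraph.Walk.length_cons] at hp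
      have h2 : T.graph.dist b T.root < T.graph.dist a T.root := by omega
      exact (edge_le ⟨hab, h2⟩).trans (ih _ (hn ▸ h2) b rfl)

theorem le_total_of_le {T : RTree.{u}} {a b c : T.V} (hb : a ≤ b) (hc : a ≤ c) :
    b ≤ c ∨ c ≤ b :=
  Relation.ReflTransGen.total_of_right_unique T.edge_rightUnique hb hc

theorem exists_in_of_lt {T : RTree.{u}} {a b : T.V} (h : a < b) : ∃ c : T.In b, a ≤ c.1 := by
  rcases Relation.ReflTransGen.cases_tail (r := T.Edge) h.le with e | ⟨c, hac, hcb⟩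
  · exact absurd e.symm h.ne
  · exact ⟨⟨c, hcb⟩, hac⟩

theorem le_of_edge_of_lt {T : RTree.{u}} {a b c : T.V} (h : T.Edge a b) (hac : a < c) : b ≤ c := by
  rcases Relation.ReflTransGen.cases_head (r := T.Edge) hac.le with e | ⟨d, had, hdc⟩
  · exact absurd e hac.ne
  · exact T.edge_rightUnique h had ▸ hdc

theorem in_lt {T : RTree.{u}} {b : T.V} (c : T.In b) : c.1 < b := edge_lt c.2

theorem in_eq_of_le_of_le {T : RTree.{u}} {a b : T.V} {c c' : T.In b} (h : a ≤ c.1) (h' : a ≤ c'.1) :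
    c = c' := by
  have key : ∀ d d' : T.In b, d.1 ≤ d'.1 → d = d' := fun d d' hd => by
    rcases hd.eq_or_lt with e | hlt
    · exact Subtype.ext e
    · exact absurd (le_of_edge_of_lt d.2 hlt) (in_lt d').not_ge
  rcases le_total_of_le h h' with e | e
  · exact key _ _ e
  · exact (key _ _ e).symm

end RTree

/-! ### Linearity of the depth-first ordering -/

namespace PRTree

open RTree

variable {P : PRTree.{u}} {x y z : P.V}

theorem dflt_irrefl (x : P.V) : ¬ P.DFLT x x := by
  rintro (h | ⟨b, c, c', hc, h, h'⟩)
  · exact lt_irrefl x h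
  · let := P.inOrder b
    exact absurd (in_eq_of_le_of_le h h') (ne_of_lt hc)

theorem dflt_trans (hxy : P.DFLT x y) (hyz : P.DFLT y z) : P.DFLT x z := by
  rcases hxy with hxy | ⟨b, c, c', hc, hx, hy⟩
  · rcases hyz with hyz | ⟨e, d, d', hd, hy', hz⟩
    · exact Or.inl (hyz.trans hxy)
    · rcases le_total_of_le hxy.le hy' with h | h
      · exact Or.inr ⟨e, d, d', hd, h, hz⟩
      · rcases h.eq_or_lt with h | h
        · exact Or.inr ⟨e, d, d', hd, h.ge, hz⟩
        · exact Or.inl ((hz.trans_lt (in_lt d')).trans_le (le_of_edge_of_lt d.2 h))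
  · rcases hyz with hyz | ⟨e, d, d', hd, hy', hz⟩
    · exact Or.inr ⟨b, c, c', hc, hx, hyz.le.trans hy⟩
    -- Both `c'` and `d` lie on the chain from `y` to the root. If they agree, the two comparisons
    -- happen at one vertex; otherwise the one nearer the root decides.
    · have hcb := in_lt c
      rcases le_total_of_le hy hy' with h | h <;> rcases h.eq_or_lt with h1 | h1
      · have hbe : b = e := P.edge_rightUnique c'.2 (by rw [h1]; exact d.2)
        subst hbe
        obtain rfl : c' = d := Subtype.ext h1
        let := P.inOrder b
        exact Or.inr ⟨b, c, d', lt_trans hc hd, hx, hz⟩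
      · exact Or.inr ⟨e, d, d', hd, hx.trans (hcb.le.trans (le_of_edge_of_lt c'.2 h1)), hz⟩
      · have hbe : b = e := P.edge_rightUnique c'.2 (by rw [← h1]; exact d.2)
        subst hbe
        obtain rfl : d = c' := Subtype.ext h1
        let := P.inOrder b
        exact Or.inr ⟨b, c, d', lt_trans hc hd, hx, hz⟩
      · exact Or.inr ⟨b, c, c', hc, hx,
          (hz.trans (in_lt d').le).trans (le_of_edge_of_lt d.2 h1)⟩

theorem dflt_asymm (h : P.DFLT x y) : ¬ P.DFLT y x := fun h' => dflt_irrefl x (dflt_trans h h')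

theorem dflt_total (h : x ≠ y) : P.DFLT x y ∨ P.DFLT y x := by
  have := P.finite
  obtain ⟨b, ⟨hxb, hyb⟩, hmin⟩ :=
    (Set.toFinite {b : P.V | x ≤ b ∧ y ≤ b}).exists_minimal ⟨P.root, le_root x, le_root y⟩
  rcases hxb.eq_or_lt with rfl | hxb
  · exact Or.inl (Or.inl (lt_of_le_of_ne hyb h.symm))
  rcases hyb.eq_or_lt with rfl | hyb
  · exact Or.inr (Or.inl hxb)
  obtain ⟨c, hc⟩ := exists_in_of_lt hxb
  obtain ⟨c', hc'⟩ := exists_in_of_lt hyb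
  have hne : c ≠ c' := by
    rintro rfl
    exact (in_lt c).not_ge (hmin ⟨hc, hc'⟩ (in_lt c).le)
  let := P.inOrder b
  rcases lt_or_gt_of_ne hne with hlt | hlt
  · exact Or.inl (Or.inr ⟨b, c, c', hlt, hc, hc'⟩)
  · exact Or.inr (Or.inr ⟨b, c', c, hlt, hc', hc⟩)

/-- The depth-first ordering as a linear order. -/
@[reducible] noncomputable def depthFirst (P : PRTree.{u}) : LinearOrder P.V :=
  @linearOrderOfSTO P.V P.DFLT
    { irrefl := dflt_irrefl
      trans := fun _ _ _ => dflt_trans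
      trichotomous := fun _ _ h h' => by
        by_contra hne
        exact (dflt_total hne).elim h h' } (Classical.decRel _)

/-- Incomparable vertices are visited in the same order as the branches at them. -/
theorem dflt_of_le_of_le {c c' : P.V} (h : P.DFLT c c') (hn : ¬ c' ≤ c) (hx : x ≤ c) (hy : y ≤ c') :
    P.DFLT x y := by
  rcases h with h | ⟨b, d, d', hd, hc, hc'⟩
  · exact absurd h.le hn
  · exact Or.inr ⟨b, d, d', hd, hx.trans hc, hy.trans hc'⟩

end PRTree

/-- A vertex of a planar rooted tree whose vertices are labelled by `α`; it stands for the branch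
at that vertex. -/
structure LabelledBranch (α : Type v) where
  tree : PRTree.{u}
  label : tree.V → α
  top : tree.V

/-! ### Kruskal's tree theorem -/

namespace LabelledBranch

open RTree PRTree

variable {α : Type v}

/-- There is an embedding of the branch `s` into the branch `t` for the tree order which preserves
the depth-first ordering and the labels. -/
def Embeds (s t : LabelledBranch.{u} α) : Prop :=
  ∃ f : s.tree.V → t.tree.V,
    (∀ x ≤ s.top, f x ≤ t.top) ∧
    (∀ x ≤ s.top, ∀ y ≤ s.top, f x ≤ f y ↔ x ≤ y) ∧
    (∀ x ≤ s.top, ∀ y ≤ s.top, s.tree.DFLT x y → t.tree.DFLT (f x) (f y)) ∧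
    ∀ x ≤ s.top, t.label (f x) = s.label x

instance : IsPreorder (LabelledBranch.{u} α) Embeds where
  refl _ := ⟨id, fun _ h => h, fun _ _ _ _ => Iff.rfl, fun _ _ _ _ h => h, fun _ _ => rfl⟩
  trans := by
    rintro s t r ⟨f, f1, f2, f3, f4⟩ ⟨g, g1, g2, g3, g4⟩
    refine ⟨g ∘ f, fun x hx => g1 _ (f1 x hx),
      fun x hx y hy => (g2 _ (f1 x hx) _ (f1 y hy)).trans (f2 x hx y hy),
      fun x hx y hy h => g3 _ (f1 x hx) _ (f1 y hy) (f3 x hx y hy h),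
      fun x hx => (g4 _ (f1 x hx)).trans (f4 x hx)⟩

/-- The branch at the source of an edge into the top. -/
def child (t : LabelledBranch.{u} α) (c : t.tree.toRTree.In t.top) : LabelledBranch.{u} α :=
  ⟨t.tree, t.label, c.1⟩

theorem Embeds.of_child {s t : LabelledBranch.{u} α} {c : t.tree.toRTree.In t.top}
    (h : Embeds s (t.child c)) : Embeds s t := by
  obtain ⟨f, f1, f2⟩ := h
  exact ⟨f, fun x hx => (f1 x hx).trans (in_lt c).le, f2⟩

/-- The number of vertices of a branch. -/
noncomputable def size (t : LabelledBranch.{u} α) : ℕ := (Set.Iic t.top).ncard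

theorem size_child_lt (t : LabelledBranch.{u} α) (c : t.tree.toRTree.In t.top) :
    (t.child c).size < t.size := by
  have : Finite t.tree.V := t.tree.finite
  have hfin : (Set.Iic t.top).Finite := Set.toFinite _
  exact Set.ncard_lt_ncard (Set.Iic_ssubset_Iic.2 (in_lt c)) hfin

/-- The embeddings of the children glue: `φ` is injective and branches at distinct incoming edges
are disjoint, so no new order relations arise. -/
theorem Embeds.of_children {s t : LabelledBranch.{u} α} (hl : t.label t.top = s.label s.top)
    (φ : s.tree.toRTree.In s.top → t.tree.toRTree.In t.top)
    (hφ : ∀ c c', (s.tree.inOrder s.top).lt c c' → (t.tree.inOrder t.top).lt (φ c) (φ c'))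
    (h : ∀ c, Embeds (s.child c) (t.child (φ c))) : Embeds s t := by
  classical
  choose g g1 g2 g3 g4 using h
  let f : s.tree.V → t.tree.V := fun x =>
    if hx : x < s.top then g (exists_in_of_lt hx).choose x else t.top
  have ftop : f s.top = t.top := dif_neg (lt_irrefl _)
  have fin : ∀ x (c : s.tree.toRTree.In s.top), x ≤ c.1 → f x = g c x := fun x c hc => by
    have hx : x < s.top := hc.trans_lt (in_lt c)
    rw [in_eq_of_le_of_le hc (exists_in_of_lt hx).choose_spec]
    exact dif_pos hx
  have fle : ∀ x (c : s.tree.toRTree.In s.top), x ≤ c.1 → f x ≤ (φ c).1 := fun x c hc => by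
    rw [fin x c hc]
    exact g1 c x hc
  have flt : ∀ x (c : s.tree.toRTree.In s.top), x ≤ c.1 → f x < t.top := fun x c hc =>
    (fle x c hc).trans_lt (in_lt _)
  have φinj : ∀ c c', φ c = φ c' → c = c' := fun c c' e => by
    let := s.tree.inOrder s.top
    let := t.tree.inOrder t.top
    exact (show StrictMono φ from fun c c' => hφ c c').injective e
  have cases : ∀ x ≤ s.top, x = s.top ∨ ∃ c : s.tree.toRTree.In s.top, x ≤ c.1 := fun x hx =>
    hx.eq_or_lt.imp_right exists_in_of_lt
  refine ⟨f, fun x hx => ?_, fun x hx y hy => ?_, fun x hx y hy hxy => ?_, fun x hx => ?_⟩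
  · rcases cases x hx with rfl | ⟨c, hc⟩
    · exact ftop.le
    · exact (flt x c hc).le
  · rcases cases x hx with rfl | ⟨c, hc⟩ <;> rcases cases y hy with rfl | ⟨c', hc'⟩
    · simp
    · rw [ftop]
      exact iff_of_false (flt y c' hc').not_ge (hc'.trans_lt (in_lt c')).not_ge
    · rw [ftop]
      exact iff_of_true (flt x c hc).le hx
    · by_cases e : c = c'
      · subst e
        rw [fin x c hc, fin y c hc']
        exact g2 c x hc y hc'
      · refine iff_of_false (fun h => e (φinj _ _ ?_)) (fun h => e ?_)
        · exact in_eq_of_le_of_le (fle x c hc) (h.trans (fle y c' hc'))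
        · exact in_eq_of_le_of_le hc (h.trans hc')
  · rcases cases x hx with rfl | ⟨c, hc⟩
    · rcases cases y hy with rfl | ⟨c', hc'⟩
      · exact absurd hxy (dflt_irrefl _)
      · rw [ftop]
        exact Or.inl (flt y c' hc')
    · rcases cases y hy with rfl | ⟨c', hc'⟩
      · exact absurd hxy (dflt_asymm (Or.inl (hc.trans_lt (in_lt c))))
      · by_cases e : c = c'
        · subst e
          rw [fin x c hc, fin y c hc']
          exact g3 c x hc y hc' hxy
        · let := s.tree.inOrder s.top
          rcases lt_or_gt_of_ne e with h | h
          · exact Or.inr ⟨_, φ c, φ c', hφ _ _ h, fle x c hc, fle y c' hc'⟩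
          · exact absurd hxy (dflt_asymm (Or.inr ⟨_, c', c, h, hc', hc⟩))
  · rcases cases x hx with rfl | ⟨c, hc⟩
    · rw [ftop, hl]
    · rw [fin x c hc]
      exact g4 c x hc

/-- The edges into the top can be listed in their given order. -/
theorem exists_children_list (t : LabelledBranch.{u} α) :
    ∃ l : List (t.tree.toRTree.In t.top),
      l.Pairwise (t.tree.inOrder t.top).lt ∧ ∀ c, c ∈ l := by
  have := t.tree.finite
  have : Finite (t.tree.toRTree.In t.top) := Subtype.finite
  have := Fintype.ofFinite (t.tree.toRTree.In t.top)
  let := t.tree.inOrder t.top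
  exact ⟨Finset.univ.sort (· ≤ ·), Finset.sortedLT_sort _ |>.pairwise, fun c => by simp⟩

theorem Embeds.of_sublistForall₂ {s t : LabelledBranch.{u} α}
    (hl : t.label t.top = s.label s.top)
    {l : List (s.tree.toRTree.In s.top)} (hs : l.Pairwise (s.tree.inOrder s.top).lt)
    (hmem : ∀ c, c ∈ l)
    {m : List (t.tree.toRTree.In t.top)} (ht : m.Pairwise (t.tree.inOrder t.top).lt)
    (h : List.SublistForall₂ Embeds (l.map s.child) (m.map t.child)) : Embeds s t := by
  rw [List.sublistForall₂_map_left_iff, List.sublistForall₂_map_right_iff,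
    List.sublistForall₂_iff] at h
  obtain ⟨m', hlm, hm'⟩ := h
  have hm := ht.sublist hm'
  obtain ⟨hlen, hlm⟩ := List.forall₂_iff_get.1 hlm
  choose i hi using fun c => List.get_of_mem (hmem c)
  refine .of_children hl (fun c => m'.get ((i c).cast hlen)) (fun c c' hc => ?_) fun c => ?_
  · refine List.pairwise_iff_get.1 hm _ _ ?_
    rw [Fin.cast_lt_cast]
    by_contra hn
    let := s.tree.inOrder s.top
    rcases (not_lt.1 hn).eq_or_lt with e | hlt
    · exact absurd ((hi c').symm.trans ((congrArg l.get e).trans (hi c))) (ne_of_gt hc)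
    · have := List.pairwise_iff_get.1 hs _ _ hlt
      rw [hi, hi] at this
      exact lt_asymm hc this
  · have := hlm (i c) (i c).2 (hlen ▸ (i c).2)
    rw [hi] at this
    exact this

/-- **Kruskal's tree theorem** for planar rooted trees with finitely many labels. -/
theorem wellQuasiOrdered_embeds [Finite α] :
    WellQuasiOrdered (Embeds : LabelledBranch.{u} α → LabelledBranch.{u} α → Prop) := by
  rw [← Set.partiallyWellOrderedOn_univ_iff,
    Set.PartiallyWellOrderedOn.iff_not_exists_isMinBadSeq size]
  rintro ⟨f, hf, hmin⟩
  -- Nash-Williams' argument: the children of a minimal bad sequence are well-quasi-ordered, and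
  -- Higman's lemma passes to lists of children.
  let S : Set (LabelledBranch.{u} α) := {b | ∃ n c, b = (f n).child c}
  have hS : S.PartiallyWellOrderedOn Embeds := by
    rw [Set.PartiallyWellOrderedOn.iff_forall_not_isBadSeq]
    rintro g ⟨hg, hbad⟩
    choose σ c hσ using hg
    obtain ⟨k, -, hk⟩ := WellFounded.has_min (measure σ).wf Set.univ ⟨0, trivial⟩
    have hk : ∀ j, σ k ≤ σ j := fun j => not_lt.1 (hk j trivial)
    -- `g j` is a child of `f (σ j)`, with `σ k` least. Following `f` before `σ k` and `g` from `k`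
    -- on is again bad, but smaller at place `σ k`.
    refine hmin (σ k) (fun n => if n < σ k then f n else g (k + (n - σ k)))
      (fun m hm => (if_pos hm).symm) ?_ ⟨fun _ => trivial, fun m n hmn hr => ?_⟩
    · simp only [lt_irrefl, if_false, Nat.sub_self, Nat.add_zero]
      rw [hσ k]
      exact size_child_lt _ _
    · dsimp only at hr
      by_cases hn : n < σ k
      · rw [if_pos hn, if_pos (hmn.trans hn)] at hr
        exact hf.2 m n hmn hr
      · rw [if_neg hn] at hr
        split_ifs at hr with hm
        · rw [hσ] at hr
          exact hf.2 m _ (hm.trans_le (hk _)) hr.of_child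
        · exact hbad _ _ (by omega) hr
  have hL := Set.PartiallyWellOrderedOn.partiallyWellOrderedOn_sublistForall₂ Embeds hS
  have : IsPreorder (List (LabelledBranch.{u} α)) (List.SublistForall₂ Embeds) :=
    { toRefl := inferInstance, toIsTrans := inferInstance }
  choose l hl hlmem using fun n => exists_children_list (f n)
  obtain ⟨φ, hφ⟩ := hL.exists_monotone_subseq (f := fun n => (l n).map (f n).child) fun n => by
    intro b hb
    obtain ⟨c, -, rfl⟩ := List.mem_map.1 hb
    exact ⟨n, c, rfl⟩
  obtain ⟨m, n, hmn, he⟩ :=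
    Finite.wellQuasiOrdered (· = ·) fun n => (f (φ n)).label (f (φ n)).top
  exact hf.2 _ _ (φ.lt_iff_lt.2 hmn)
    (.of_sublistForall₂ he.symm (hl _) (hlmem _) (hl _) (hφ m n hmn.le))

end LabelledBranch

/-! ### The three Gröbner conditions -/

namespace PRTree

open RTree

variable {P Q : PRTree.{u}}

instance (P : PRTree.{u}) : Finite P.V := P.finite

/-- A root-preserving map that preserves and reflects the tree order and preserves the depth-first
ordering is a morphism of planar rooted trees. -/
def homOfFun (f : P.V → Q.V) (hle : ∀ x y, f x ≤ f y ↔ x ≤ y) (hroot : f P.root = Q.root)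
    (hdflt : ∀ x y, P.DFLT x y → Q.DFLT (f x) (f y)) : P ⟶ Q where
  hom := ⟨OrderEmbedding.ofMapLEIff f hle, hroot⟩
  map_dflt := hdflt

theorem hom_ext {f g : P ⟶ Q} (h : ∀ x, f.hom.emb x = g.hom.emb x) : f = g :=
  Hom.ext (RTree.Hom.ext (RelEmbedding.ext h))

theorem nonempty_iso_of_equiv (e : P.V ≃ Q.V) (hle : ∀ x y, e x ≤ e y ↔ x ≤ y)
    (hdflt : ∀ x y, Q.DFLT (e x) (e y) ↔ P.DFLT x y) : Nonempty (P ≅ Q) := by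
  have hle' : ∀ x y, e.symm x ≤ e.symm y ↔ x ≤ y := fun x y => by
    rw [← hle, e.apply_symm_apply, e.apply_symm_apply]
  have hdflt' : ∀ x y, P.DFLT (e.symm x) (e.symm y) ↔ Q.DFLT x y := fun x y => by
    rw [← hdflt, e.apply_symm_apply, e.apply_symm_apply]
  have hroot : e P.root = Q.root := by
    refine le_antisymm (le_root _) ?_
    rw [← e.apply_symm_apply Q.root, hle]
    exact le_root _
  exact ⟨{
    hom := homOfFun e hle hroot fun x y => (hdflt x y).2
    inv := homOfFun e.symm hle' (by rw [← hroot, e.symm_apply_apply]) fun x y => (hdflt' x y).2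
    hom_inv_id := hom_ext e.symm_apply_apply
    inv_hom_id := hom_ext e.apply_symm_apply }⟩

theorem nonempty_iso_of_encoding_eq {n m : ℕ} (e : P.V ≃ Fin n) (e' : Q.V ≃ Fin m)
    (h : (⟨n, fun i j => e.symm i ≤ e.symm j, fun i j => P.DFLT (e.symm i) (e.symm j)⟩ :
        Σ n : ℕ, (Fin n → Fin n → Prop) × (Fin n → Fin n → Prop)) =
      ⟨m, fun i j => e'.symm i ≤ e'.symm j, fun i j => Q.DFLT (e'.symm i) (e'.symm j)⟩) :
    Nonempty (P ≅ Q) := by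
  obtain ⟨rfl, h⟩ := Sigma.mk.inj_iff.1 h
  obtain ⟨h1, h2⟩ := Prod.mk_inj.1 (eq_of_heq h)
  refine nonempty_iso_of_equiv (e.trans e'.symm) (fun x y => ?_) fun x y => ?_
  · simpa using (iff_of_eq (congrFun (congrFun h1 (e x)) (e y))).symm
  · simpa using (iff_of_eq (congrFun (congrFun h2 (e x)) (e y))).symm

/-- The two orders, transported to `Fin n`, determine the tree up to isomorphism, and there are only
countably many such codes. -/
theorem essentiallySmall : EssentiallySmall.{u} PRTree.{u} := by
  choose n e using fun P : PRTree.{u} => Finite.exists_equiv_fin P.V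
  let code : PRTree.{u} → Σ n : ℕ, (Fin n → Fin n → Prop) × (Fin n → Fin n → Prop) := fun P =>
    ⟨n P, fun i j => (e P).some.symm i ≤ (e P).some.symm j,
      fun i j => P.DFLT ((e P).some.symm i) ((e P).some.symm j)⟩
  refine (essentiallySmall_iff _).2 ⟨small_of_injective
    (f := fun X : Skeleton PRTree.{u} => code ((fromSkeleton _).obj X)) fun X Y h => ?_,
    inferInstance⟩
  obtain ⟨i⟩ := nonempty_iso_of_encoding_eq _ _ h
  exact skeleton_skeletal _ ⟨(fromSkeleton _).preimageIso i⟩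

/-- The vertices of a planar rooted tree, ordered by the depth-first ordering. -/
def DepthFirst (P : PRTree.{u}) : Type u := P.V

noncomputable instance : LinearOrder P.DepthFirst := P.depthFirst

instance : Finite P.DepthFirst := P.finite

theorem endomorphism_eq_id (f : P ⟶ P) : f = 𝟙 P := by
  let g : P.DepthFirst → P.DepthFirst := f.hom.emb
  have hlt : StrictMono g := fun x y => f.map_dflt x y
  exact hom_ext fun x => DFunLike.congr_fun
    (OrderHom.eq_id_of_injective ⟨g, hlt.monotone⟩ hlt.injective) x

theorem wellQuasiOrdered_divides (P : PRTree.{u}) : WellQuasiOrdered (Divides P) := by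
  intro F
  -- The label is `some u` at the image of `u` and `none` off the image. Preserving labels thus
  -- forces the factorization, and with it preservation of the root.
  let branch : MorphismsFrom P → LabelledBranch.{u} (Option P.V) := fun f =>
    ⟨f.1, Function.partialInv f.2.hom.emb, f.1.root⟩
  obtain ⟨m, n, hmn, g, -, hle, hdflt, hlabel⟩ :=
    LabelledBranch.wellQuasiOrdered_embeds fun n => branch (F n)
  have hfac : ∀ u, g ((F m).2.hom.emb u) = (F n).2.hom.emb u := fun u => by
    have h := hlabel ((F m).2.hom.emb u) (le_root _)
    have h1 : Function.partialInv (F m).2.hom.emb ((F m).2.hom.emb u) = some u :=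
      Function.partialInv_left (F m).2.hom.emb.injective u
    exact (((F n).2.hom.emb.injective.isPartialInv _ _).1 (h.trans h1)).symm
  refine ⟨m, n, hmn, homOfFun g (fun x y => hle x (le_root _) y (le_root _)) ?_
    fun x y => hdflt x (le_root _) y (le_root _), hom_ext hfac⟩
  rw [← (F n).2.hom.map_root, ← (F m).2.hom.map_root]
  exact hfac _

/-- A morphism as the family of its values, indexed in the depth-first ordering. -/
def values (f : P ⟶ Q) : Lex (P.DepthFirst → Q.DepthFirst) := toLex f.hom.emb

theorem values_injective : Function.Injective (values : (P ⟶ Q) → _) := fun _ _ h =>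
  hom_ext fun x => congrFun (toLex_inj.1 h) x

/-- Composing with `g` keeps the first place of difference, and `g` is strictly increasing there. -/
theorem values_comp_le {R : PRTree.{u}} {f f' : P ⟶ Q} (g : Q ⟶ R) (h : values f ≤ values f') :
    values (f ≫ g) ≤ values (f' ≫ g) := by
  rcases h.eq_or_lt with h | ⟨i, hj, hi⟩
  · rw [values_injective h]
  · exact le_of_lt ⟨i, fun j hji => congrArg g.hom.emb (hj j hji), g.map_dflt _ _ hi⟩

instance : Finite (P ⟶ Q) :=
  Finite.of_injective (fun f => (f.hom.emb : P.V → Q.V)) fun _ _ h => hom_ext fun x => congrFun h x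

end PRTree

/-- Orders on the finite sets of morphisms from `x` to the various objects which are compatible with
composition combine to an admissible order. -/
theorem exists_isAdmissible {C : Type u} [Category.{v} C] (x : C) [∀ y, Finite (x ⟶ y)]
    (o : ∀ y, LinearOrder (x ⟶ y))
    (ho : ∀ (y z : C) (f f' : x ⟶ y) (g : y ⟶ z),
      (o y).le f f' → (o z).le (f ≫ g) (f' ≫ g)) :
    ∃ o : LinearOrder (MorphismsFrom x), IsAdmissible x o := by
  let : LinearOrder C := @linearOrderOfSTO _ WellOrderingRel _ (Classical.decRel _)
  have wf : WellFounded ((· < ·) : C → C → Prop)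
    := (inferInstance : IsWellOrder C WellOrderingRel).wf
  -- Codomains are compared first, by a well-order; each fibre is finite, so minima exist.
  let O : LinearOrder (MorphismsFrom x) :=
    LinearOrder.lift' (toLex : (Σ y, (x ⟶ y)) → Σₗ y, (x ⟶ y)) toLex.injective
  refine ⟨O, ?_, fun y z f f' g h => ?_⟩
  · refine WellFounded.wellFounded_iff_has_min.2 fun s ⟨a, ha⟩ => ?_
    obtain ⟨y, ⟨f, hf⟩, hy⟩ := wf.has_min {y | ∃ f, (⟨y, f⟩ : MorphismsFrom x) ∈ s} ⟨a.1, a.2, ha⟩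
    obtain ⟨g, hg, hmin⟩ := (Set.toFinite {f | (⟨y, f⟩ : MorphismsFrom x) ∈ s}).exists_minimal
      ⟨f, hf⟩
    refine ⟨⟨y, g⟩, hg, fun ⟨z, h⟩ hs hlt => ?_⟩
    rcases Sigma.Lex.lt_def.1 hlt with h1 | ⟨h1, h2⟩
    · exact hy z ⟨h, hs⟩ h1
    · dsimp only at h1
      subst h1
      exact h2.not_ge (hmin hs h2.le)
  · rcases Sigma.Lex.le_def.1 h with h1 | ⟨h1, h2⟩
    · exact absurd h1 (lt_irrefl y)
    · exact Sigma.Lex.le_def.2 (Or.inr ⟨rfl, ho y z f f' g h2⟩)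

/-! ### The forgetful functor and property (F) -/

namespace PRTree

open RTree

theorem isGroebner : IsGroebner PRTree.{u} where
  essentiallySmall := essentiallySmall
  directed _ := endomorphism_eq_id
  wellQuasiOrdered := wellQuasiOrdered_divides
  admissible x := exists_isAdmissible x (fun _ => LinearOrder.lift' values values_injective)
    fun _ _ _ _ g h => values_comp_le g h

theorem forget_essSurj : forget.{u}.EssSurj where
  mem_essImage T :=
    ⟨⟨T, fun _ => @linearOrderOfSTO _ WellOrderingRel _ (Classical.decRel _)⟩, ⟨Iso.refl _⟩⟩

/-- Every order embedding of a rooted tree into a planar one preserves the depth-first ordering for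
some planar structure on its domain. -/
theorem exists_planar_of_hom {T : RTree.{u}} {Q : PRTree.{u}} (f : T ⟶ forget.obj Q) :
    ∃ (o : ∀ b : T.V, LinearOrder (T.In b)) (g : (⟨T, o⟩ : PRTree.{u}) ⟶ Q), g.hom = f := by
  let val : ∀ b, T.In b → Q.DepthFirst := fun b c => f.emb c.1
  have hval : ∀ b, Function.Injective (val b) := fun b c c' h =>
    Subtype.ext (f.emb.injective h)
  refine ⟨fun b => LinearOrder.lift' (val b) (hval b), ⟨f, ?_⟩, rfl⟩
  rintro x y (h | ⟨b, c, c', hc, hx, hy⟩)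
  · exact Or.inl (f.emb.lt_iff_lt.2 h)
  -- The images of distinct siblings are incomparable, so their order extends to everything in their
  -- branches.
  · refine dflt_of_le_of_le (c := f.emb c.1) (c' := f.emb c'.1) hc (fun h => ?_)
      (f.emb.le_iff_le.2 hx) (f.emb.le_iff_le.2 hy)
    have e : c' = c := in_eq_of_le_of_le le_rfl (f.emb.le_iff_le.1 h)
    exact dflt_irrefl (P := Q) (f.emb c.1) (by subst e; exact hc)

end PRTree

instance {α : Type u} [Finite α] : Finite (LinearOrder α) :=
  Finite.of_injective (fun o : LinearOrder α => o.le) fun _ _ h =>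
    LinearOrder.ext fun x y => iff_of_eq (congrFun (congrFun h x) y)

/-- Property (F) holds if every morphism from `x` into the image of the functor factors through one
of finitely many such morphisms. -/
theorem hasPropertyF_of_finite_factorization (k : Type w) [Field k] {C : Type u} [Category.{v} C]
    {D : Type t} [Category.{v} D] (F : D ⥤ C)
    (h : ∀ x : C, ∃ (ι : Type v) (_ : Finite ι) (y : ι → D) (f : ∀ i, x ⟶ F.obj (y i)),
      ∀ (z : D) (f' : x ⟶ F.obj z), ∃ (i : ι) (g : y i ⟶ z), f i ≫ F.map g = f') :
    HasPropertyF k F := by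
  intro x
  obtain ⟨ι, _, y, f, hf⟩ := h x
  obtain ⟨n, ⟨e⟩⟩ := Finite.exists_equiv_fin ι
  refine ⟨n, fun i => y (e.symm i), fun i => (Finsupp.single (f (e.symm i)) 1 :
    (x ⟶ F.obj (y (e.symm i))) →₀ k), fun z => ?_⟩
  refine (Submodule.eq_top_iff').2 fun (m : (x ⟶ F.obj z) →₀ k) => ?_
  induction m using Finsupp.induction_linear with
  | zero => exact Submodule.zero_mem _
  | add a b ha hb => exact Submodule.add_mem _ ha hb
  | single f' a =>
    obtain ⟨i, g, rfl⟩ := hf z f'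
    rw [← mul_one a, ← smul_eq_mul, ← Finsupp.smul_single]
    refine Submodule.smul_mem _ _ (Submodule.subset_span ?_)
    obtain ⟨j, rfl⟩ := e.symm.surjective i
    refine ⟨j, g, ?_⟩
    exact (Finsupp.mapDomain_single (f := fun f => f ≫ F.map g)).symm

theorem PRTree.forget_hasPropertyF (k : Type w) [Field k] : HasPropertyF k PRTree.forget.{u} := by
  refine hasPropertyF_of_finite_factorization k _ fun T => ?_
  have := T.finite
  have : ∀ b, Finite (T.In b) := fun b => Subtype.finite
  refine ⟨∀ b, LinearOrder (T.In b), inferInstance, fun o => ⟨T, o⟩, fun _ => 𝟙 T,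
    fun Q f => ?_⟩
  obtain ⟨o, g, rfl⟩ := exists_planar_of_hom f
  exact ⟨o, g, Category.id_comp g.hom⟩

theorem theorem2p1 :
    IsGroebner PRTree.{u} ∧
    PRTree.forget.{u}.EssSurj ∧
    (∀ (k : Type w) [Field k], HasPropertyF k PRTree.forget.{u}) ∧
    (∀ (k : Type w) [Field k], IsQuasiGroebner k RTree.{u}) :=
  ⟨PRTree.isGroebner, PRTree.forget_essSurj, fun k _ => PRTree.forget_hasPropertyF k,
    fun k _ => ⟨PRTree, inferInstance, PRTree.forget, PRTree.isGroebner, PRTree.forget_essSurj,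
      PRTree.forget_hasPropertyF k⟩⟩
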